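/- Let $T>0$, $E=[0,T]$, and let $M_+(E)$ be the set of finite non-negative Borel measures on $E$, with $\langle\phi,\nu\rangle=\int_E\phi(x)\,\nu(dx)$. Let $(\Omega,\mathcal F,(\mathcal F_t)_{t\in[0,T]},\mathbb P)$ be a filtered probability space with right-continuous filtration. All local martingales below are adapted and have almost surely càdlàg paths. For all $0\le\tau_1<\tau_2\le T$ let $w(\,\cdot\,;\tau_1,\tau_2)\in C^\infty(\mathbb R)$ be a real-valued weight function. Let $\mathbb Q$ be a probability measure equivalent to $\mathbb P$ and let $(\mu_t)_{t\in[0,T]}$ be an adapted $M_+(E)$-valued process such that $$\mathbb E_{\mathbb Q}\Big[\sup_{t\in[0,T]}\mu_t(E)\Big]<\infty .$$ Assume that for every $\phi\in C^\infty(\mathbb R)$ with $\phi'(0)=0$ the process $$\langle\phi,\mu_t\rangle+\int_0^t\langle\phi',\mu_s\rangle\,ds,\qquad t\in[0,T],$$ is a $\mathbb Q$-local martingale with respect to $(\mathcal F_t)_{t\in[0,T]}$. Then for all $0\le\tau_1<\tau_2\le T$ the future price process $$F(t,\tau_1,\tau_2)=\int_E w(t+x;\tau_1,\tau_2)\,\mathbf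 1_{(\tau_1,\tau_2]}(t+x)\,\mu_t(dx),\qquad t\in[0,\tau_1],$$ is a $\mathbb Q$-martingale with respect to $(\mathcal F_t)_{t\in[0,\tau_1]}$ with almost surely càdlàg paths. In particular, the market satisfies NAFLVR (no asymptotic free lunch with vanishing risk) in the following sense: there is a probability measure equivalent to $\mathbb P$ under which all the processes $(F(t,\tau_1,\tau_2))_{t\in[0,\tau_1]}$, $0\le\tau_1<\tau_2\le T$, are local martingales. -/

import Mathlib

open MeasureTheory ProbabilityTheory Filter Set
open scoped ENNReal Topology

noncomputable section

namespace MeasureHJM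

/-- The path `f` is right-continuous and has a left limit at every time. -/
def IsCadlag {ι : Type*} [TopologicalSpace ι] [Preorder ι] (f : ι → ℝ) : Prop :=
  ∀ t : ι, ContinuousWithinAt f (Ici t) t ∧ ∃ l : ℝ, Tendsto f (𝓝[<] t) (𝓝 l)

/-- `X` is a `Q`-local martingale on `[0, S]`: it is adapted, its paths are almost surely càdlàg,
and there are stopping times `σ 0 ≤ σ 1 ≤ …` such that every stopped process
`X^{σ n} 1_{σ n > 0}` is a martingale. Stopping times take values in `[0, S] ∪ {⊤}`, and the
localizing condition `σ n → ⊤` almost surely says that `σ n = ⊤` for all large `n`. -/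
structure IsLocalMartingale {Ω : Type*} {mΩ : MeasurableSpace Ω} {S : ℝ} (hS : 0 ≤ S)
    (𝓕 : Filtration (Icc (0 : ℝ) S) mΩ) (Q : Measure Ω) (X : Icc (0 : ℝ) S → Ω → ℝ) : Prop where
  adapted : StronglyAdapted 𝓕 X
  cadlag : ∀ᵐ ω ∂Q, IsCadlag fun t => X t ω
  localizing : haveI : Fact ((0 : ℝ) ≤ S) := ⟨hS⟩; Locally (fun Y => Martingale Y 𝓕 Q) 𝓕 X Q

/-- The inclusion of the time interval `[0, S]` into `[0, T]`. -/
def timeInclusion {S T : ℝ} (h : S ≤ T) : Icc (0 : ℝ) S → Icc (0 : ℝ) T :=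
  Set.inclusion (Icc_subset_Icc_right h)

/-- The filtration `(ℱ_t)_{t ∈ [0, S]}` obtained from `(ℱ_t)_{t ∈ [0, T]}`. -/
def restrictFiltration {Ω : Type*} {mΩ : MeasurableSpace Ω} {S T : ℝ} (h : S ≤ T)
    (𝓕 : Filtration (Icc (0 : ℝ) T) mΩ) : Filtration (Icc (0 : ℝ) S) mΩ where
  seq t := 𝓕 (timeInclusion h t)
  mono' _ _ hst := 𝓕.mono hst
  le' t := 𝓕.le (timeInclusion h t)

/-- `⟨φ, ν⟩`, the integral over `E = [0, T]` of `φ` against the finite measure `ν` on `E`. -/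
def pairing {T : ℝ} (φ : ℝ → ℝ) (ν : FiniteMeasure (Icc (0 : ℝ) T)) : ℝ :=
  ∫ x : Icc (0 : ℝ) T, φ (x : ℝ) ∂(ν : Measure (Icc (0 : ℝ) T))

/-- The smooth functions on the real line with vanishing derivative at zero. -/
def testFunctions : Set (ℝ → ℝ) :=
  {φ | ContDiff ℝ (⊤ : ℕ∞) φ ∧ deriv φ 0 = 0}

/-- The process `⟨φ, μ_t⟩ + ∫_0^t ⟨φ', μ_s⟩ ds`, `t ∈ [0, T]`. The projection onto `[0, T]` only
turns the real integration variable `s ∈ [0, t]` into an element of `[0, T]`. -/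
def driftProcess {Ω : Type*} {T : ℝ} (μ : Icc (0 : ℝ) T → Ω → FiniteMeasure (Icc (0 : ℝ) T))
    (φ : ℝ → ℝ) (t : Icc (0 : ℝ) T) (ω : Ω) : ℝ :=
  pairing φ (μ t ω) +
    ∫ s in (0 : ℝ)..t, pairing (deriv φ) (μ (projIcc 0 T (t.2.1.trans t.2.2) s) ω)

/-- The future price `F(t, τ₁, τ₂) = ∫_E w(t + x; τ₁, τ₂) 1_{(τ₁, τ₂]}(t + x) μ_t(dx)`; it is the
price of a traded contract for `t ≤ τ₁`. -/
def futurePrice {Ω : Type*} {T : ℝ} (w : ℝ → ℝ → ℝ → ℝ)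
    (μ : Icc (0 : ℝ) T → Ω → FiniteMeasure (Icc (0 : ℝ) T)) (τ₁ τ₂ : ℝ)
    (t : Icc (0 : ℝ) T) (ω : Ω) : ℝ :=
  pairing (fun x => (Ioc τ₁ τ₂).indicator (fun u => w u τ₁ τ₂) ((t : ℝ) + x)) (μ t ω)

/-- The no-arbitrage condition for the market with price processes `(F τ₁ τ₂ t)_{t ∈ [0, τ₁]}`,
`0 ≤ τ₁ < τ₂ ≤ T`: there is one probability measure equivalent to `P` under which all of them are
local martingales. -/
def NAFLVR {Ω : Type*} {mΩ : MeasurableSpace Ω} {T : ℝ} (P : Measure Ω)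
    (𝓕 : Filtration (Icc (0 : ℝ) T) mΩ) (F : ℝ → ℝ → Icc (0 : ℝ) T → Ω → ℝ) : Prop :=
  ∃ Q : Measure Ω, IsProbabilityMeasure Q ∧ Q ≪ P ∧ P ≪ Q ∧
    ∀ (τ₁ τ₂ : ℝ) (h₀ : 0 ≤ τ₁) (h₁ : τ₁ < τ₂) (h₂ : τ₂ ≤ T),
      IsLocalMartingale h₀ (restrictFiltration (h₁.le.trans h₂) 𝓕) Q
        (fun t => F τ₁ τ₂ (timeInclusion (h₁.le.trans h₂) t))

end MeasureHJM

end

/-! Formally, the drift condition is a transport equation with velocity -1 plus martingale noise, so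
$\langle g(t+\cdot),\mu_t\rangle$ has no drift as long as $g'(t)=0$, which puts $x\mapsto g(t+x)$
among the test functions. The payoff $g=w\,\mathbf 1_{(\tau_1,\tau_2]}$ vanishes up to $\tau_1$,
which explains the restriction $t\le\tau_1$; it is not smooth and is replaced by smooth compactly
supported $g_n\to g$ that vanish on $(-\infty,\tau_1]$.

For smooth $g$ the test function moves with time, so it is frozen at the later time: for $r<r'$ the
increment of $\langle g(r+\cdot),\mu_r\rangle$ equals the martingale increment belonging to
$g(r'+\cdot)$ plus a pathwise defect. The defect is $O(r'-r)$ with an integrable constant, and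
$o(r'-r)$ as $r'\downarrow r$ because paths are right-continuous. Hence $r\mapsto\mathbb E_{\mathbb
Q}[\mathbf 1_A\langle g(r+\cdot),\mu_r\rangle]$ is Lipschitz with zero right derivative, and so
constant (`setIntegral_translatedPairing_eq`).

Path regularity comes from the even monomials: they are test functions, and polynomials in $x^2$ are
dense in $C([0,T])$ (`exists_integrable_ae_isRegularPath`). The same lemma gives an integrable bound
on the mass, which turns local martingales into martingales. Dominated convergence passes the
martingale property from $g_n$ to $g$, and Doob's inequality passes on the càdlàg paths
(`ae_isCadlag_of_tendsto_of_dominated`). -/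

noncomputable section

namespace MeasureHJM

/-! ### Integrals against finite measures on `[0, T]`. -/

section Pairing

variable {T : ℝ}

/-- The total mass of a finite measure on `[0, T]`, as a real number. -/
def totalMass (ν : FiniteMeasure (Icc (0 : ℝ) T)) : ℝ :=
  (ν : Measure (Icc (0 : ℝ) T)).real univ

lemma totalMass_nonneg (ν : FiniteMeasure (Icc (0 : ℝ) T)) : 0 ≤ totalMass ν :=
  measureReal_nonneg

lemma pairing_const (c : ℝ) (ν : FiniteMeasure (Icc (0 : ℝ) T)) :
    pairing (fun _ => c) ν = c * totalMass ν := by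
  simp [pairing, totalMass, mul_comm]

lemma integrable_of_bounded {φ : ℝ → ℝ} (hφ : Measurable φ) {B : ℝ}
    (hB : ∀ x ∈ Icc (0 : ℝ) T, |φ x| ≤ B) (ν : FiniteMeasure (Icc (0 : ℝ) T)) :
    Integrable (fun x : Icc (0 : ℝ) T => φ x) (ν : Measure (Icc (0 : ℝ) T)) :=
  Integrable.of_bound (hφ.comp measurable_subtype_coe).aestronglyMeasurable B
    (ae_of_all _ fun x => hB x x.2)

lemma measurable_pairing {φ : ℝ → ℝ} (hφ : Measurable φ) {B : ℝ}
    (hB : ∀ x ∈ Icc (0 : ℝ) T, |φ x| ≤ B) :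
    Measurable fun ν : FiniteMeasure (Icc (0 : ℝ) T) => pairing φ ν := by
  -- The σ-algebra on measures makes integrals of non-negative functions measurable, so the signed
  -- integral is split.
  have h : (fun ν : FiniteMeasure (Icc (0 : ℝ) T) => pairing φ ν) =
      fun ν : FiniteMeasure (Icc (0 : ℝ) T) =>
      (∫⁻ x : Icc (0 : ℝ) T, ENNReal.ofReal (φ x) ∂(ν : Measure (Icc (0 : ℝ) T))).toReal -
      (∫⁻ x : Icc (0 : ℝ) T, ENNReal.ofReal (-φ x) ∂(ν : Measure (Icc (0 : ℝ) T))).toReal := by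
    funext ν
    exact integral_eq_lintegral_pos_part_sub_lintegral_neg_part (integrable_of_bounded hφ hB ν)
  rw [h]
  have hφ' : Measurable fun x : Icc (0 : ℝ) T => φ x := hφ.comp measurable_subtype_coe
  exact (((Measure.measurable_lintegral hφ'.ennreal_ofReal).comp
    measurable_subtype_coe).ennreal_toReal).sub
    ((Measure.measurable_lintegral hφ'.neg.ennreal_ofReal).comp
    measurable_subtype_coe).ennreal_toReal

lemma integrable_of_continuous {φ : ℝ → ℝ} (hφ : Continuous φ)
    (ν : FiniteMeasure (Icc (0 : ℝ) T)) :
    Integrable (fun x : Icc (0 : ℝ) T => φ x) (ν : Measure (Icc (0 : ℝ) T)) := by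
  obtain ⟨B, hB⟩ := isCompact_Icc.exists_bound_of_continuousOn (hφ.continuousOn (s := Icc 0 T))
  exact integrable_of_bounded hφ.measurable hB ν

lemma abs_pairing_le {φ : ℝ → ℝ} {B : ℝ} (hB : ∀ x ∈ Icc (0 : ℝ) T, |φ x| ≤ B)
    (ν : FiniteMeasure (Icc (0 : ℝ) T)) : |pairing φ ν| ≤ B * totalMass ν :=
  norm_integral_le_of_norm_le_const (f := fun x : Icc (0 : ℝ) T => φ x)
    (ae_of_all _ fun x => hB x x.2)

lemma pairing_add {φ ψ : ℝ → ℝ} (hφ : Continuous φ) (hψ : Continuous ψ)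
    (ν : FiniteMeasure (Icc (0 : ℝ) T)) :
    pairing (fun x => φ x + ψ x) ν = pairing φ ν + pairing ψ ν :=
  integral_add (integrable_of_continuous hφ ν) (integrable_of_continuous hψ ν)

lemma pairing_sub {φ ψ : ℝ → ℝ} (hφ : Continuous φ) (hψ : Continuous ψ)
    (ν : FiniteMeasure (Icc (0 : ℝ) T)) :
    pairing (fun x => φ x - ψ x) ν = pairing φ ν - pairing ψ ν :=
  integral_sub (integrable_of_continuous hφ ν) (integrable_of_continuous hψ ν)

lemma pairing_mul (c : ℝ) (φ : ℝ → ℝ) (ν : FiniteMeasure (Icc (0 : ℝ) T)) :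
    pairing (fun x => c * φ x) ν = c * pairing φ ν :=
  integral_const_mul _ _

lemma abs_pairing_sub_le {φ ψ : ℝ → ℝ} (hφ : Continuous φ) (hψ : Continuous ψ) {B : ℝ}
    (hB : ∀ x ∈ Icc (0 : ℝ) T, |φ x - ψ x| ≤ B) (ν : FiniteMeasure (Icc (0 : ℝ) T)) :
    |pairing φ ν - pairing ψ ν| ≤ B * totalMass ν := by
  rw [← pairing_sub hφ hψ]
  exact abs_pairing_le hB ν

end Pairing

/-! ### Dyadic grids and right-continuous paths. -/

section Grid

variable {S : ℝ}

/-- The grid point `k / 2 ^ n`, projected onto `[0, S]`. -/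
def gridPoint (hS : 0 ≤ S) (n k : ℕ) : Icc (0 : ℝ) S :=
  projIcc 0 S hS (k / 2 ^ n)

/-- The first grid point of level `n` strictly to the right of `t` (or the end point `S`). -/
def gridNext (hS : 0 ≤ S) (n : ℕ) (t : Icc (0 : ℝ) S) : Icc (0 : ℝ) S :=
  gridPoint hS n (⌊(t : ℝ) * 2 ^ n⌋₊ + 1)

lemma le_gridNext (hS : 0 ≤ S) (n : ℕ) (t : Icc (0 : ℝ) S) : t ≤ gridNext hS n t := by
  have h : (t : ℝ) ≤ ((⌊(t : ℝ) * 2 ^ n⌋₊ + 1 : ℕ) : ℝ) / 2 ^ n := by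
    rw [le_div_iff₀ (by positivity)]
    push_cast
    exact (Nat.lt_floor_add_one _).le
  calc t = projIcc 0 S hS t := (projIcc_val hS t).symm
    _ ≤ _ := monotone_projIcc hS h

lemma tendsto_gridNext (hS : 0 ≤ S) (t : Icc (0 : ℝ) S) :
    Tendsto (fun n => gridNext hS n t) atTop (𝓝[≥] t) := by
  refine tendsto_nhdsWithin_iff.2 ⟨?_, Eventually.of_forall fun n => le_gridNext hS n t⟩
  have h : Tendsto (fun n : ℕ => ((⌊(t : ℝ) * 2 ^ n⌋₊ + 1 : ℕ) : ℝ) / 2 ^ n) atTop (𝓝 (t : ℝ)) := by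
    have h0 : Tendsto (fun n : ℕ => (t : ℝ) + (1 / 2 : ℝ) ^ n) atTop (𝓝 (t : ℝ)) := by
      simpa using (tendsto_pow_atTop_nhds_zero_of_lt_one (by norm_num : (0 : ℝ) ≤ 1 / 2)
        (by norm_num)).const_add (t : ℝ)
    refine tendsto_of_tendsto_of_tendsto_of_le_of_le tendsto_const_nhds h0 (fun n => ?_) fun n => ?_
    · rw [le_div_iff₀ (by positivity)]
      push_cast
      exact (Nat.lt_floor_add_one _).le
    · rw [div_le_iff₀ (by positivity), add_mul, ← mul_pow]
      push_cast
      have := Nat.floor_le (mul_nonneg t.2.1 (by positivity : (0 : ℝ) ≤ 2 ^ n))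
      norm_num
      exact this
  have h2 := (continuous_projIcc (h := hS)).continuousAt.tendsto.comp h
  rw [projIcc_val] at h2
  exact h2

lemma tendsto_comp_gridNext (hS : 0 ≤ S) {f : Icc (0 : ℝ) S → ℝ} {t : Icc (0 : ℝ) S}
    (hf : ContinuousWithinAt f (Ici t) t) :
    Tendsto (fun n => f (gridNext hS n t)) atTop (𝓝 (f t)) :=
  hf.tendsto.comp (tendsto_gridNext hS t)

/-- Right-continuity makes `f` the pointwise limit of step functions that factor through an
integer-valued floor. -/
lemma measurable_of_rightContinuous (hS : 0 ≤ S) {f : Icc (0 : ℝ) S → ℝ}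
    (hf : ∀ t, ContinuousWithinAt f (Ici t) t) : Measurable f := by
  refine measurable_of_tendsto_metrizable (f := fun n t => f (gridNext hS n t)) (fun n => ?_)
    (tendsto_pi_nhds.2 fun t => tendsto_comp_gridNext hS (hf t))
  have : Measurable fun t : Icc (0 : ℝ) S => ⌊(t : ℝ) * 2 ^ n⌋₊ :=
    Nat.measurable_floor.comp (measurable_subtype_coe.mul_const _)
  exact (measurable_from_nat (f := fun k => f (gridPoint hS n (k + 1)))).comp this

lemma le_of_forall_gridPoint_le (hS : 0 ≤ S) {f : Icc (0 : ℝ) S → ℝ} {C : ℝ}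
    (hf : ∀ t, ContinuousWithinAt f (Ici t) t) (h : ∀ n k, f (gridPoint hS n k) ≤ C)
    (t : Icc (0 : ℝ) S) : f t ≤ C :=
  le_of_tendsto' (tendsto_comp_gridNext hS (hf t)) fun n => h n _

end Grid

/-! ### Stability of càdlàg paths and of measurability. -/

section Cadlag

variable {ι : Type*} [TopologicalSpace ι] [Preorder ι]

lemma IsCadlag.add {f g : ι → ℝ} (hf : IsCadlag f) (hg : IsCadlag g) :
    IsCadlag fun t => f t + g t := fun t => by
  obtain ⟨l, hl⟩ := (hf t).2
  obtain ⟨m, hm⟩ := (hg t).2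
  exact ⟨(hf t).1.add (hg t).1, l + m, hl.add hm⟩

lemma IsCadlag.const_mul {f : ι → ℝ} (c : ℝ) (hf : IsCadlag f) :
    IsCadlag fun t => c * f t := fun t => by
  obtain ⟨l, hl⟩ := (hf t).2
  exact ⟨(hf t).1.const_mul c, c * l, hl.const_mul c⟩

lemma isCadlag_of_continuous {f : ι → ℝ} (hf : Continuous f) : IsCadlag f := fun t =>
  ⟨hf.continuousWithinAt, f t, hf.continuousWithinAt⟩

lemma IsCadlag.of_uniform_approx {f : ι → ℝ}
    (h : ∀ ε > 0, ∃ g : ι → ℝ, IsCadlag g ∧ ∀ t, |f t - g t| ≤ ε) : IsCadlag f := by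
  intro t
  constructor
  · refine Metric.tendsto_nhds.2 fun ε hε => ?_
    obtain ⟨g, hg, hfg⟩ := h (ε / 4) (by positivity)
    filter_upwards [Metric.tendsto_nhds.1 (hg t).1 (ε / 4) (by positivity)] with x hx
    rw [Real.dist_eq] at hx ⊢
    have h1 := abs_le.1 (hfg x)
    have h2 := abs_le.1 (hfg t)
    have h3 := abs_lt.1 hx
    exact abs_lt.2 ⟨by linarith, by linarith⟩
  · rcases (𝓝[<] t).eq_or_neBot with hb | hb
    · exact ⟨0, by rw [hb]; exact tendsto_bot⟩
    -- No candidate for the left limit is at hand, so it comes from completeness: near `t` on the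
    -- left, `f` stays close to the left limit of `g`.
    · rw [← cauchy_map_iff_exists_tendsto]
      refine Metric.cauchy_iff.2 ⟨inferInstance, fun ε hε => ?_⟩
      obtain ⟨g, hg, hfg⟩ := h (ε / 8) (by positivity)
      obtain ⟨l, hl⟩ := (hg t).2
      refine ⟨f '' {x | dist (g x) l < ε / 8},
        image_mem_map (Metric.tendsto_nhds.1 hl (ε / 8) (by positivity)), ?_⟩
      rintro _ ⟨x, hx, rfl⟩ _ ⟨y, hy, rfl⟩
      rw [mem_ofPred_eq, Real.dist_eq] at hx hy
      rw [Real.dist_eq]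
      have h1 := abs_le.1 (hfg x)
      have h2 := abs_le.1 (hfg y)
      have h3 := abs_lt.1 hx
      have h4 := abs_lt.1 hy
      exact abs_lt.2 ⟨by linarith, by linarith⟩

end Cadlag

lemma measurable_of_uniform_approx {α : Type*} [MeasurableSpace α] {f : α → ℝ}
    (h : ∀ ε > 0, ∃ g : α → ℝ, Measurable g ∧ ∀ t, |f t - g t| ≤ ε) : Measurable f := by
  choose! g hg hfg using h
  have hpos : ∀ n : ℕ, (0 : ℝ) < 1 / ((n : ℝ) + 1) := fun n => by positivity
  refine measurable_of_tendsto_metrizable (f := fun n : ℕ => g (1 / ((n : ℝ) + 1)))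
    (fun n => hg _ (hpos n)) (tendsto_pi_nhds.2 fun t => ?_)
  rw [tendsto_iff_dist_tendsto_zero]
  refine squeeze_zero (fun _ => dist_nonneg) (fun n => ?_) tendsto_one_div_add_atTop_nhds_zero_nat
  rw [dist_comm]
  exact hfg _ (hpos n) t

/-- The primitive of a non-negative function is measurable even if the function is not. -/
lemma measurable_primitive_of_nonneg {T : ℝ} {k : ℝ → ℝ} (hk : ∀ s, 0 ≤ k s) :
    Measurable fun t : Icc (0 : ℝ) T => ∫ s in (0 : ℝ)..t, k s := by
  have hnn : ∀ t : Icc (0 : ℝ) T, 0 ≤ ∫ s in (0 : ℝ)..t, k s := fun t =>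
    intervalIntegral.integral_nonneg t.2.1 fun s _ => hk s
  refine measurable_of_Ioi fun c => ?_
  -- A superlevel set need not be an up-set, since the integral drops to its default value 0 once
  -- integrability fails. It is still order connected: for `c ≥ 0`, a value above `c` at `z` forces
  -- integrability on `[0, z]`, where the primitive is monotone.
  refine OrdConnected.measurableSet ⟨fun x hx z hz y hy => ?_⟩
  rcases lt_or_ge c 0 with hc | hc
  · exact hc.trans_le (hnn y)
  · have hz' : IntervalIntegrable k volume 0 z := by
      by_contra hne
      have : c < ∫ s in (0 : ℝ)..z, k s := hz
      rw [intervalIntegral.integral_undef hne] at this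
      exact this.not_ge hc
    refine lt_of_lt_of_le (show c < _ from hx) ?_
    refine intervalIntegral.integral_mono_interval le_rfl x.2.1 hy.1
      (ae_of_all _ hk) (hz'.mono_set ?_)
    exact uIcc_subset_uIcc_left (by rw [uIcc_of_le z.2.1]; exact ⟨y.2.1, hy.2⟩)

/-! ### Regularity of one path, from the even monomials. -/

section Path

variable {T : ℝ}

/-- A property of real paths that is stable under linear combinations and uniform limits holds for
the pairings of a bounded path of measures with all continuous functions as soon as it holds for
the pairings with the even monomials. -/
lemma pairing_induction_even_monomial {m : Icc (0 : ℝ) T → FiniteMeasure (Icc (0 : ℝ) T)} {C : ℝ}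
    (hC : ∀ t, totalMass (m t) ≤ C) {p : (Icc (0 : ℝ) T → ℝ) → Prop}
    (hadd : ∀ f g, p f → p g → p fun t => f t + g t) (hmul : ∀ (c : ℝ) f, p f → p fun t => c * f t)
    (hlim : ∀ f, (∀ ε > 0, ∃ g : Icc (0 : ℝ) T → ℝ, p g ∧ ∀ t, |f t - g t| ≤ ε) → p f)
    (hmono : ∀ k : ℕ, p fun t => pairing (fun x => x ^ (2 * k)) (m t))
    {ψ : ℝ → ℝ} (hψ : Continuous ψ) : p fun t => pairing ψ (m t) := by
  refine hlim _ fun ε hε => ?_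
  have hε' : 0 < ε / (|C| + 1) := by positivity
  -- Weierstrass in the variable `y = x ^ 2`: since `x ≥ 0`, `q (x ^ 2)` approximates `ψ x` using
  -- even powers only.
  obtain ⟨q, hq⟩ := exists_polynomial_near_of_continuousOn 0 (T ^ 2) (fun y => ψ (√y))
    (hψ.comp Real.continuous_sqrt).continuousOn _ hε'
  refine ⟨fun t => pairing (fun x => q.eval (x ^ 2)) (m t), ?_, fun t => ?_⟩
  · clear hq
    induction q using Polynomial.induction_on' with
    | add q r hq hr =>
      have : (fun t => pairing (fun x => (q + r).eval (x ^ 2)) (m t)) = fun t =>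
          pairing (fun x => q.eval (x ^ 2)) (m t) + pairing (fun x => r.eval (x ^ 2)) (m t) := by
        funext t
        simp_rw [Polynomial.eval_add]
        exact pairing_add (q.continuous.comp (continuous_pow 2)) (r.continuous.comp (continuous_pow 2))
          (m t)
      rw [this]
      exact hadd _ _ hq hr
    | monomial n a =>
      have : (fun t => pairing (fun x => (Polynomial.monomial n a).eval (x ^ 2)) (m t)) = fun t =>
          a * pairing (fun x => x ^ (2 * n)) (m t) := by
        funext t
        simp_rw [Polynomial.eval_monomial, ← pow_mul]
        exact pairing_mul a _ _
      rw [this]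
      exact hmul _ _ (hmono n)
  · refine (abs_pairing_sub_le hψ (q.continuous.comp (continuous_pow 2))
      (B := ε / (|C| + 1)) (fun x hx => ?_) (m t)).trans ?_
    · have := hq (x ^ 2) ⟨sq_nonneg x, pow_le_pow_left₀ hx.1 hx.2 2⟩
      simp only [Real.sqrt_sq hx.1] at this
      rw [abs_sub_comm]
      exact this.le
    · have : totalMass (m t) ≤ |C| + 1 := (hC t).trans ((le_abs_self C).trans (by linarith))
      calc ε / (|C| + 1) * totalMass (m t) ≤ ε / (|C| + 1) * (|C| + 1) := by gcongr
        _ = ε := by field_simp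

lemma intervalIntegrable_of_measurable_of_abs_le {k : ℝ → ℝ} (hk : Measurable k) {B : ℝ}
    (hB : ∀ s, |k s| ≤ B) (a b : ℝ) : IntervalIntegrable k volume a b := by
  refine IntervalIntegrable.mono_fun (g := k) (f := fun _ => B) intervalIntegrable_const
    hk.aestronglyMeasurable (ae_of_all _ fun s => ?_)
  exact (hB s).trans (le_abs_self B)

lemma intervalIntegrable_pairing (hT : 0 ≤ T) {m : Icc (0 : ℝ) T → FiniteMeasure (Icc (0 : ℝ) T)}
    {C : ℝ} (hC : ∀ t, totalMass (m t) ≤ C) {ψ : ℝ → ℝ} (hψ : Continuous ψ)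
    (hm : Measurable fun t => pairing ψ (m t)) (a b : ℝ) :
    IntervalIntegrable (fun s => pairing ψ (m (projIcc 0 T hT s))) volume a b := by
  obtain ⟨B, hB⟩ := isCompact_Icc.exists_bound_of_continuousOn (hψ.continuousOn (s := Icc 0 T))
  refine intervalIntegrable_of_measurable_of_abs_le (B := |B| * C)
    (hm.comp continuous_projIcc.measurable) (fun s => ?_) a b
  refine (abs_pairing_le (fun x hx => (hB x hx).trans (le_abs_self B)) _).trans ?_
  gcongr
  exact hC _

variable {Ω : Type*} {μ : Icc (0 : ℝ) T → Ω → FiniteMeasure (Icc (0 : ℝ) T)} {ω : Ω} {C : ℝ}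

lemma deriv_even_monomial (k : ℕ) :
    deriv (fun x : ℝ => x ^ (2 * k)) = fun x => ((2 * k : ℕ) : ℝ) * x ^ (2 * k - 1) := by
  funext x
  simp

lemma even_monomial_mem_testFunctions (k : ℕ) : (fun x : ℝ => x ^ (2 * k)) ∈ testFunctions := by
  refine ⟨by fun_prop, ?_⟩
  rw [deriv_even_monomial]
  rcases k with _ | k
  · simp
  · simp [mul_add]

/-- Continuity of the drift integral presupposes a measurable integrand, which is not known
beforehand. For an even monomial the derivative is non-negative on `[0, T]`, so the drift integral
is measurable in `t` regardless, and can be subtracted from the càdlàg drift process. -/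
lemma measurable_pairing_path (hT : 0 ≤ T) (hC : ∀ t, totalMass (μ t ω) ≤ C)
    (h : ∀ k : ℕ, IsCadlag fun t => driftProcess μ (fun x => x ^ (2 * k)) t ω)
    {ψ : ℝ → ℝ} (hψ : Continuous ψ) : Measurable fun t => pairing ψ (μ t ω) := by
  refine pairing_induction_even_monomial (p := Measurable) hC (fun f g hf hg => hf.add hg)
    (fun c f hf => hf.const_mul c) (fun f => measurable_of_uniform_approx) (fun k => ?_) hψ
  have hD : Measurable fun t => driftProcess μ (fun x => x ^ (2 * k)) t ω :=
    measurable_of_rightContinuous hT fun t => (h k t).1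
  have hI : Measurable fun t : Icc (0 : ℝ) T => ∫ s in (0 : ℝ)..t,
      pairing (deriv fun x => x ^ (2 * k)) (μ (projIcc 0 T hT s) ω) := by
    refine measurable_primitive_of_nonneg fun s => integral_nonneg fun x => ?_
    have := x.2.1
    rw [deriv_even_monomial]
    positivity
  convert! hD.sub hI using 2 with t
  simp [driftProcess]

/-- Once the integrand is known to be measurable and bounded, the drift integral is continuous, and
subtracting it preserves càdlàg paths. -/
lemma isCadlag_pairing_path (hT : 0 ≤ T) (hC : ∀ t, totalMass (μ t ω) ≤ C)
    (h : ∀ k : ℕ, IsCadlag fun t => driftProcess μ (fun x => x ^ (2 * k)) t ω)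
    {ψ : ℝ → ℝ} (hψ : Continuous ψ) : IsCadlag fun t => pairing ψ (μ t ω) := by
  refine pairing_induction_even_monomial (p := IsCadlag) hC (fun f g hf hg => hf.add hg)
    (fun c f hf => hf.const_mul c) (fun f => IsCadlag.of_uniform_approx) (fun k => ?_) hψ
  have hc : Continuous (deriv fun x : ℝ => x ^ (2 * k)) := by
    rw [deriv_even_monomial]; fun_prop
  have hI : Continuous fun t : Icc (0 : ℝ) T => ∫ s in (0 : ℝ)..t,
      pairing (deriv fun x => x ^ (2 * k)) (μ (projIcc 0 T hT s) ω) :=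
    (intervalIntegral.continuous_primitive (fun a b => intervalIntegrable_pairing hT hC hc
      (measurable_pairing_path hT hC h hc) a b) 0).comp continuous_subtype_val
  convert! (h k).add ((isCadlag_of_continuous hI).const_mul (-1)) using 2 with t
  simp [driftProcess]

/-- The pairing of a translated continuous function of compact support with a path of measures. -/
lemma isCadlag_pairing_translate {m : Icc (0 : ℝ) T → FiniteMeasure (Icc (0 : ℝ) T)}
    (hC : ∀ t, totalMass (m t) ≤ C)
    (h : ∀ ψ : ℝ → ℝ, Continuous ψ → IsCadlag fun t => pairing ψ (m t))
    {g : ℝ → ℝ} (hg : Continuous g) (hgc : HasCompactSupport g) :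
    IsCadlag fun t : Icc (0 : ℝ) T => pairing (fun x => g (t + x)) (m t) := by
  intro t
  have hu := hgc.uniformContinuous_of_continuous hg
  -- By uniform continuity of `g` and the mass bound, moving the translate costs nothing in the
  -- limit, so the translate may be frozen at `t`.
  have he : Tendsto (fun s : Icc (0 : ℝ) T => pairing (fun x => g (s + x)) (m s) -
      pairing (fun x => g (t + x)) (m s)) (𝓝 t) (𝓝 0) := by
    refine Metric.tendsto_nhds.2 fun ε hε => ?_
    have hε' : 0 < ε / (2 * (|C| + 1)) := by positivity
    obtain ⟨δ, hδ, hδ'⟩ := Metric.uniformContinuous_iff.1 hu _ hε'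
    filter_upwards [Metric.ball_mem_nhds t hδ] with s hs
    rw [Real.dist_eq, sub_zero]
    refine (abs_pairing_sub_le (B := ε / (2 * (|C| + 1))) (by fun_prop) (by fun_prop)
      (fun x _ => (hδ' ?_).le) _).trans_lt ?_
    · rw [dist_add_right]; exact hs
    · have : totalMass (m s) ≤ |C| + 1 := (hC s).trans ((le_abs_self C).trans (by linarith))
      calc ε / (2 * (|C| + 1)) * totalMass (m s) ≤ ε / (2 * (|C| + 1)) * (|C| + 1) := by gcongr
        _ = ε / 2 := by field_simp
        _ < ε := by linarith
  have hc := h (fun x => g (t + x)) (by fun_prop) t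
  obtain ⟨l, hl⟩ := hc.2
  constructor
  · have := hc.1.tendsto.add (he.mono_left nhdsWithin_le_nhds)
    simpa [ContinuousWithinAt] using this
  · refine ⟨l, ?_⟩
    have := hl.add (he.mono_left nhdsWithin_le_nhds)
    simpa [ContinuousWithinAt] using this

end Path

/-! ### Integrable mass bound, martingale criteria and a maximal inequality. -/

section RegularPaths

variable {Ω : Type*} {mΩ : MeasurableSpace Ω} {Q : Measure Ω}

section Regularity

variable {T : ℝ} {𝓕 : Filtration (Icc (0 : ℝ) T) mΩ}
  {μ : Icc (0 : ℝ) T → Ω → FiniteMeasure (Icc (0 : ℝ) T)}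

/-- A bounded path of measures whose pairings with continuous functions are càdlàg. -/
def IsRegularPath (m : Icc (0 : ℝ) T → FiniteMeasure (Icc (0 : ℝ) T)) (C : ℝ) : Prop :=
  (∀ t, totalMass (m t) ≤ C) ∧ ∀ ψ : ℝ → ℝ, Continuous ψ → IsCadlag fun t => pairing ψ (m t)

/-- The constant 1 has no drift, so right-continuity of the mass is available before any mass bound.
-/
lemma driftProcess_pow_zero (t : Icc (0 : ℝ) T) (ω : Ω) :
    driftProcess μ (fun x => x ^ (2 * 0)) t ω = totalMass (μ t ω) := by
  simp only [driftProcess, mul_zero, pow_zero, deriv_const', pairing_const, zero_mul,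
    intervalIntegral.integral_zero, add_zero, one_mul]

/-- The supremum over all times need not be measurable. The supremum over the countable grid is,
lies below it, and almost surely still bounds the mass at every time by right-continuity. -/
lemma exists_integrable_ae_isRegularPath (hT : 0 ≤ T) (hμ : Adapted 𝓕 μ)
    (hsup : ∫⁻ ω, ⨆ t, (μ t ω : Measure (Icc (0 : ℝ) T)) univ ∂Q < ∞)
    (hdrift : ∀ φ ∈ testFunctions, IsLocalMartingale hT 𝓕 Q (driftProcess μ φ)) :
    ∃ G : Ω → ℝ, Integrable G Q ∧ ∀ᵐ ω ∂Q, IsRegularPath (fun t => μ t ω) (G ω) := by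
  have hcad : ∀ᵐ ω ∂Q, ∀ k : ℕ, IsCadlag fun t => driftProcess μ (fun x => x ^ (2 * k)) t ω :=
    ae_all_iff.2 fun k => (hdrift _ (even_monomial_mem_testFunctions k)).cadlag
  set M : Ω → ℝ≥0∞ := fun ω =>
    ⨆ n, ⨆ k, (μ (gridPoint hT n k) ω : Measure (Icc (0 : ℝ) T)) univ with hM
  have hMm : Measurable M := by
    refine Measurable.iSup fun n => Measurable.iSup fun k => ?_
    exact (Measure.measurable_coe MeasurableSet.univ).comp
      (measurable_subtype_coe.comp ((hμ (gridPoint hT n k)).mono (𝓕.le _) le_rfl))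
  have hle : ∀ᵐ ω ∂Q, ∀ t, (μ t ω : Measure (Icc (0 : ℝ) T)) univ ≤ M ω := by
    filter_upwards [hcad] with ω hω t
    have h0 : ∀ t, ContinuousWithinAt (fun t => totalMass (μ t ω)) (Ici t) t := fun t => by
      simpa only [driftProcess_pow_zero] using (hω 0 t).1
    have h1 := (ENNReal.continuous_ofReal.tendsto _).comp (tendsto_comp_gridNext hT (h0 t))
    have h2 : ∀ t, ENNReal.ofReal (totalMass (μ t ω)) = (μ t ω : Measure (Icc (0 : ℝ) T)) univ :=
      fun t => ofReal_measureReal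
    rw [← h2]
    refine le_of_tendsto' h1 fun n => ?_
    simp only [Function.comp_apply, h2]
    exact le_iSup₂_of_le (f := fun n k => (μ (gridPoint hT n k) ω : Measure (Icc (0 : ℝ) T)) univ)
      n _ le_rfl
  have hMint : ∫⁻ ω, M ω ∂Q ≠ ∞ := by
    refine ((lintegral_mono fun ω => ?_).trans_lt hsup).ne
    exact iSup₂_le fun n k => le_iSup (fun t => (μ t ω : Measure (Icc (0 : ℝ) T)) univ) _
  refine ⟨fun ω => (M ω).toReal, integrable_toReal_of_lintegral_ne_top hMm.aemeasurable hMint, ?_⟩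
  filter_upwards [hle, hcad, ae_lt_top hMm hMint] with ω hω hω' hfin
  have hb : ∀ t, totalMass (μ t ω) ≤ (M ω).toReal := fun t =>
    ENNReal.toReal_mono hfin.ne (hω t)
  exact ⟨hb, fun ψ hψ => isCadlag_pairing_path hT hb hω' hψ⟩

end Regularity

section Martingale

lemma isLocalMartingale_of_martingale {S : ℝ} (hS : 0 ≤ S)
    {𝓕 : Filtration (Icc (0 : ℝ) S) mΩ} {X : Icc (0 : ℝ) S → Ω → ℝ} (hX : Martingale X 𝓕 Q)
    (hc : ∀ᵐ ω ∂Q, IsCadlag fun t => X t ω) : IsLocalMartingale hS 𝓕 Q X where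
  adapted := hX.stronglyAdapted
  cadlag := hc
  localizing := by
    have : Fact ((0 : ℝ) ≤ S) := ⟨hS⟩
    exact Locally.of_prop hX

variable [IsProbabilityMeasure Q]

lemma martingale_of_setIntegral_eq {ι : Type*} [Preorder ι] {𝓕 : Filtration ι mΩ} {X : ι → Ω → ℝ}
    (hadp : StronglyAdapted 𝓕 X) (hint : ∀ t, Integrable (X t) Q)
    (h : ∀ i j, i ≤ j → ∀ A, MeasurableSet[𝓕 i] A → ∫ ω in A, X i ω ∂Q = ∫ ω in A, X j ω ∂Q) :
    Martingale X 𝓕 Q := by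
  refine ⟨hadp, fun i j hij => ?_⟩
  refine (ae_eq_condExp_of_forall_setIntegral_eq (𝓕.le i) (hint j)
    (fun A _ _ => (hint i).integrableOn) (fun A hA _ => h i j hij A hA)
    (hadp i).aestronglyMeasurable).symm

/-- The martingale property is an identity between integrals over sets, and these converge by
domination. -/
lemma Martingale.of_tendsto_of_dominated {ι : Type*} [Preorder ι] {𝓕 : Filtration ι mΩ}
    {X : ι → Ω → ℝ} {Y : ℕ → ι → Ω → ℝ} (hY : ∀ n, Martingale (Y n) 𝓕 Q)
    (hX : StronglyAdapted 𝓕 X) {G : Ω → ℝ} (hG : Integrable G Q)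
    (hYG : ∀ n t, ∀ᵐ ω ∂Q, |Y n t ω| ≤ G ω)
    (hlim : ∀ t, ∀ᵐ ω ∂Q, Tendsto (fun n => Y n t ω) atTop (𝓝 (X t ω))) :
    Martingale X 𝓕 Q := by
  have hYm : ∀ n t, AEStronglyMeasurable (Y n t) Q := fun n t =>
    (((hY n).stronglyAdapted t).mono (𝓕.le t)).aestronglyMeasurable
  have hint : ∀ t, Integrable (X t) Q := fun t => by
    refine hG.mono ((hX t).mono (𝓕.le t)).aestronglyMeasurable ?_
    filter_upwards [ae_all_iff.2 fun n => hYG n t, hlim t] with ω h1 h2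
    exact (le_of_tendsto' h2.abs h1).trans (le_abs_self _)
  refine martingale_of_setIntegral_eq hX hint fun i j hij A hA => ?_
  have hl : ∀ t, Tendsto (fun n => ∫ ω in A, Y n t ω ∂Q) atTop (𝓝 (∫ ω in A, X t ω ∂Q)) :=
    fun t => tendsto_integral_of_dominated_convergence G (fun n => (hYm n t).restrict)
      hG.integrableOn (fun n => ae_restrict_of_ae (hYG n t)) (ae_restrict_of_ae (hlim t))
  refine tendsto_nhds_unique (hl i) ?_
  simp_rw [fun n => (hY n).setIntegral_eq hij hA]
  exact hl j

lemma IsLocalMartingale.martingale_of_dominated {S : ℝ} {hS : 0 ≤ S}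
    {𝓕 : Filtration (Icc (0 : ℝ) S) mΩ} {X : Icc (0 : ℝ) S → Ω → ℝ}
    (hX : IsLocalMartingale hS 𝓕 Q X) {G : Ω → ℝ} (hG : Integrable G Q)
    (hXG : ∀ᵐ ω ∂Q, ∀ t, |X t ω| ≤ G ω) : Martingale X 𝓕 Q := by
  have : Fact ((0 : ℝ) ≤ S) := ⟨hS⟩
  obtain ⟨τ, hτ, hM⟩ := hX.localizing
  refine Martingale.of_tendsto_of_dominated hM hX.adapted hG (fun n t => ?_) fun t => ?_
  · filter_upwards [hXG] with ω hω
    simp only [stoppedProcess, indicator_apply]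
    split_ifs
    · exact hω _
    · simpa using (abs_nonneg _).trans (hω t)
  · filter_upwards [hτ.tendsto_top] with ω hω
    -- A localizing time beyond the last time `S` can only be `⊤`, so the stopped process eventually
    -- equals `X`.
    have h1 := (WithTop.tendsto_nhds_top_iff _).1 hω ⟨S, hS, le_rfl⟩
    refine tendsto_const_nhds.congr' ?_
    filter_upwards [h1] with n hn
    have htop : τ n ω = ⊤ := by
      by_contra hne
      obtain ⟨a, ha⟩ := WithTop.ne_top_iff_exists.1 hne
      rw [← ha, WithTop.coe_lt_coe] at hn
      exact hn.not_ge a.2.2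
    simp [stoppedProcess, htop]

/-- Doob's maximal inequality on the dyadic grid. -/
lemma measure_exists_gridPoint_le {S : ℝ} (hS : 0 ≤ S) {𝓕 : Filtration (Icc (0 : ℝ) S) mΩ}
    {Z : Icc (0 : ℝ) S → Ω → ℝ} (hZ : Martingale Z 𝓕 Q) {ε : ℝ} (hε : 0 < ε) :
    ENNReal.ofReal ε * Q {ω | ∃ n k, ε ≤ |Z (gridPoint hS n k) ω|} ≤
      ENNReal.ofReal (∫ ω, |Z ⟨S, hS, le_rfl⟩ ω| ∂Q) := by
  lift ε to NNReal using hε.le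
  rw [ENNReal.ofReal_coe_nnreal]
  set A : ℕ → Set Ω := fun n => {ω | ∃ k, ε ≤ |Z (gridPoint hS n k) ω|} with hA
  have hU : {ω | ∃ n k, ε ≤ |Z (gridPoint hS n k) ω|} = ⋃ n, A n := by
    ext ω; simp [hA]
  have hmono : Monotone A := by
    refine monotone_nat_of_le_succ fun n ω hω => ?_
    obtain ⟨k, hk⟩ := hω
    refine ⟨2 * k, ?_⟩
    have : gridPoint hS (n + 1) (2 * k) = gridPoint hS n k := by
      unfold gridPoint
      congr 1
      push_cast
      rw [pow_succ]
      field_simp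
    rwa [this]
  rw [hU, hmono.measure_iUnion, ENNReal.mul_iSup]
  refine iSup_le fun n => ?_
  have hgm : Monotone (gridPoint hS n) := fun i j hij => by
    refine monotone_projIcc hS ?_
    gcongr
  let 𝓖 : Filtration ℕ mΩ :=
    { seq := fun k => 𝓕 (gridPoint hS n k)
      mono' := fun i j hij => 𝓕.mono (hgm hij)
      le' := fun k => 𝓕.le _ }
  have hsub : Martingale (fun k => Z (gridPoint hS n k)) 𝓖 Q :=
    ⟨fun k => hZ.1 _, fun i j hij => hZ.2 _ _ (hgm hij)⟩
  have habs : Submartingale (fun k ω => |Z (gridPoint hS n k) ω|) 𝓖 Q :=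
    hsub.submartingale.sup hsub.neg.submartingale
  -- From index `N` on all grid points are `S`, so the supremum over `k` is a finite maximum.
  obtain ⟨N, hN⟩ : ∃ N : ℕ, S * 2 ^ n ≤ N := exists_nat_ge _
  have hend : ∀ k, N ≤ k → gridPoint hS n k = ⟨S, hS, le_rfl⟩ := fun k hk => by
    refine projIcc_of_right_le hS ?_
    rw [le_div_iff₀ (by positivity)]
    exact hN.trans (by exact_mod_cast hk)
  have hmax := maximal_ineq habs (fun k ω => abs_nonneg _) (ε := ε) N
  have hset : A n = {ω | (ε : ℝ) ≤
      (Finset.range (N + 1)).sup' Finset.nonempty_range_add_one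
        fun k => |Z (gridPoint hS n k) ω|} := by
    ext ω
    simp only [hA, mem_ofPred_eq, Finset.le_sup'_iff, Finset.mem_range]
    refine ⟨fun ⟨k, hk⟩ => ⟨min k N, by omega, ?_⟩, fun ⟨k, _, hk⟩ => ⟨k, hk⟩⟩
    rcases le_total k N with h | h
    · rwa [min_eq_left h]
    · rw [min_eq_right h, hend N le_rfl]
      rwa [hend k h] at hk
  rw [hset]
  refine hmax.trans (ENNReal.ofReal_le_ofReal ?_)
  rw [hend N le_rfl]
  exact setIntegral_le_integral (hZ.integrable _).abs (ae_of_all _ fun ω => abs_nonneg _)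

end Martingale

end RegularPaths

/-! ### Pathwise error of freezing the translated test function. -/

section TransportDefect

variable {T : ℝ}

/-- The difference between `⟨g (r' + ·) - g (r + ·), n_r⟩` and `∫_r^r' ⟨g' (r' + ·), n_u⟩ du`. -/
def transportDefect (n : ℝ → FiniteMeasure (Icc (0 : ℝ) T)) (g : ℝ → ℝ) (r r' : ℝ) : ℝ :=
  pairing (fun x => g (r' + x)) (n r) - pairing (fun x => g (r + x)) (n r) -
    ∫ u in r..r', pairing (fun x => deriv g (r' + x)) (n u)

variable {n : ℝ → FiniteMeasure (Icc (0 : ℝ) T)} {C : ℝ} {g : ℝ → ℝ}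

lemma abs_transportDefect_le (hC : ∀ u, totalMass (n u) ≤ C) (hg : ContDiff ℝ 1 g) {L : ℝ}
    (hL : ∀ y, |deriv g y| ≤ L) {r r' : ℝ} (hr : r ≤ r') :
    |transportDefect n g r r'| ≤ 2 * L * C * (r' - r) := by
  have hL0 : 0 ≤ L := (abs_nonneg _).trans (hL 0)
  have hgc := hg.continuous
  have hd : Differentiable ℝ g := hg.differentiable (by norm_num)
  have h1 : |pairing (fun x => g (r' + x)) (n r) - pairing (fun x => g (r + x)) (n r)| ≤
      L * C * (r' - r) := by
    refine (abs_pairing_sub_le (B := L * (r' - r)) (by fun_prop) (by fun_prop)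
      (fun x _ => ?_) _).trans ?_
    · have := Convex.norm_image_sub_le_of_norm_deriv_le (f := g) (s := univ) (C := L)
        (fun y _ => hd y) (fun y _ => hL y) convex_univ (mem_univ (r + x)) (mem_univ (r' + x))
      simpa [Real.norm_eq_abs, abs_of_nonneg (sub_nonneg.2 hr)] using this
    · have : 0 ≤ r' - r := sub_nonneg.2 hr
      calc L * (r' - r) * totalMass (n r) ≤ L * (r' - r) * C := by gcongr; exact hC r
        _ = _ := by ring
  have h2 : |∫ u in r..r', pairing (fun x => deriv g (r' + x)) (n u)| ≤ L * C * (r' - r) := by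
    have := intervalIntegral.norm_integral_le_of_norm_le_const (a := r) (b := r') (C := L * C)
      (f := fun u => pairing (fun x => deriv g (r' + x)) (n u)) fun u _ =>
        (abs_pairing_le (fun x _ => hL _) _).trans (mul_le_mul_of_nonneg_left (hC u) hL0)
    rwa [abs_of_nonneg (sub_nonneg.2 hr)] at this
  calc _ ≤ _ := abs_sub _ _
    _ ≤ L * C * (r' - r) + L * C * (r' - r) := add_le_add h1 h2
    _ = _ := by ring

/-- Both halves of the defect equal `(r' - r) * pairing (fun x => deriv g (r + x)) (n r)` up to
`o(r' - r)`: the first by the mean value theorem, the second by right-continuity of the path, each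
with uniform continuity of `deriv g`. -/
lemma tendsto_transportDefect_div (hC : ∀ u, totalMass (n u) ≤ C)
    (hint : ∀ ψ : ℝ → ℝ, Continuous ψ → ∀ a b,
      IntervalIntegrable (fun u => pairing ψ (n u)) volume a b)
    (hrc : ∀ ψ : ℝ → ℝ, Continuous ψ → ∀ u,
      ContinuousWithinAt (fun u => pairing ψ (n u)) (Ici u) u)
    (hg : ContDiff ℝ 1 g) (hgs : HasCompactSupport g) (r : ℝ) :
    Tendsto (fun r' => (r' - r)⁻¹ * transportDefect n g r r') (𝓝[>] r) (𝓝 0) := by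
  have hgc := hg.continuous
  have hd : Differentiable ℝ g := hg.differentiable (by norm_num)
  have hg' : Continuous (deriv g) := hg.continuous_deriv le_rfl
  have hC0 : 0 ≤ C := (totalMass_nonneg _).trans (hC 0)
  have hu := hgs.deriv.uniformContinuous_of_continuous hg'
  refine Metric.tendsto_nhds.2 fun ε hε => ?_
  -- The two halves contribute `e * C` and `e * C + e` per unit of time.
  obtain ⟨e, he, heε⟩ : ∃ e > 0, e * (2 * C + 1) < ε :=
    ⟨ε / (2 * (2 * C + 1)), by positivity, by
      rw [div_mul_eq_mul_div, div_lt_iff₀ (by positivity)]; nlinarith⟩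
  obtain ⟨η, hη, hη'⟩ := Metric.uniformContinuous_iff.1 hu e he
  have hev := Metric.tendsto_nhds.1 (hrc (fun x => deriv g (r + x)) (by fun_prop) r) e he
  obtain ⟨c, hc, hc'⟩ := mem_nhdsGE_iff_exists_Ico_subset.1 hev
  filter_upwards [Ioo_mem_nhdsGT (lt_min hc (lt_add_of_pos_right r hη))] with r' hr'
  have hδ : 0 < r' - r := sub_pos.2 hr'.1
  have hr'c : r' < c := hr'.2.trans_le (min_le_left _ _)
  have hr'η : r' - r < η := by linarith [hr'.2.trans_le (min_le_right c (r + η))]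
  have h1 : |pairing (fun x => g (r' + x)) (n r) - pairing (fun x => g (r + x)) (n r) -
      (r' - r) * pairing (fun x => deriv g (r + x)) (n r)| ≤ e * C * (r' - r) := by
    rw [← pairing_sub (by fun_prop) (by fun_prop), ← pairing_mul, ← pairing_sub (by fun_prop)
      (by fun_prop)]
    refine (abs_pairing_le (B := e * (r' - r)) (fun x _ => ?_) _).trans ?_
    · obtain ⟨y, hy, hy'⟩ := exists_deriv_eq_slope g (a := r + x) (b := r' + x) (by linarith)
        hgc.continuousOn hd.differentiableOn
      have h3 : g (r' + x) - g (r + x) = (r' - r) * deriv g y := by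
        rw [hy']
        have : r' + x - (r + x) = r' - r := by ring
        rw [this]
        field_simp
      rw [h3, ← mul_sub, abs_mul, abs_of_pos hδ, mul_comm]
      gcongr
      refine (hη' ?_).le
      rw [Real.dist_eq, abs_lt]
      constructor <;> linarith [hy.1, hy.2]
    · calc e * (r' - r) * totalMass (n r) ≤ e * (r' - r) * C := by gcongr; exact hC r
        _ = _ := by ring
  have h2 : |(∫ u in r..r', pairing (fun x => deriv g (r' + x)) (n u)) -
      (r' - r) * pairing (fun x => deriv g (r + x)) (n r)| ≤ (e * C + e) * (r' - r) := by
    have h3 : (∫ u in r..r', pairing (fun x => deriv g (r' + x)) (n u)) -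
        (r' - r) * pairing (fun x => deriv g (r + x)) (n r) =
        ∫ u in r..r', (pairing (fun x => deriv g (r' + x)) (n u) -
          pairing (fun x => deriv g (r + x)) (n r)) := by
      rw [intervalIntegral.integral_sub (hint _ (by fun_prop) _ _) intervalIntegrable_const,
        intervalIntegral.integral_const, smul_eq_mul]
    rw [h3]
    have h4 := intervalIntegral.norm_integral_le_of_norm_le_const (a := r) (b := r')
      (C := e * C + e) (f := fun u => pairing (fun x => deriv g (r' + x)) (n u) -
        pairing (fun x => deriv g (r + x)) (n r)) fun u hu => by
      rw [uIoc_of_le hr'.1.le] at hu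
      have h5 : |pairing (fun x => deriv g (r' + x)) (n u) -
          pairing (fun x => deriv g (r + x)) (n u)| ≤ e * C := by
        refine (abs_pairing_sub_le (B := e) (by fun_prop) (by fun_prop)
          (fun x _ => (hη' ?_).le) _).trans (by gcongr; exact hC u)
        rw [dist_add_right, Real.dist_eq, abs_of_pos hδ]
        exact hr'η
      have h6 : |pairing (fun x => deriv g (r + x)) (n u) -
          pairing (fun x => deriv g (r + x)) (n r)| < e := hc' ⟨hu.1.le, hu.2.trans_lt hr'c⟩
      calc _ ≤ _ := abs_sub_le _ (pairing (fun x => deriv g (r + x)) (n u)) _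
        _ ≤ _ := add_le_add h5 h6.le
    rwa [abs_of_pos hδ] at h4
  rw [Real.dist_eq, sub_zero, abs_mul, abs_inv, abs_of_pos hδ, inv_mul_lt_iff₀ hδ]
  have h7 : |transportDefect n g r r'| ≤ e * C * (r' - r) + (e * C + e) * (r' - r) := by
    have : transportDefect n g r r' = (pairing (fun x => g (r' + x)) (n r) -
        pairing (fun x => g (r + x)) (n r) -
        (r' - r) * pairing (fun x => deriv g (r + x)) (n r)) -
        ((∫ u in r..r', pairing (fun x => deriv g (r' + x)) (n u)) -
        (r' - r) * pairing (fun x => deriv g (r + x)) (n r)) := by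
      unfold transportDefect; ring
    rw [this]
    exact (abs_sub _ _).trans (add_le_add h1 h2)
  nlinarith

end TransportDefect

/-! ### Conservation of expectations along the moving test function. -/

section Conservation

variable {Ω : Type*} {mΩ : MeasurableSpace Ω} {Q : Measure Ω}
  {T : ℝ} {𝓕 : Filtration (Icc (0 : ℝ) T) mΩ}
  {μ : Icc (0 : ℝ) T → Ω → FiniteMeasure (Icc (0 : ℝ) T)} {G : Ω → ℝ}

section Path

variable {m : Icc (0 : ℝ) T → FiniteMeasure (Icc (0 : ℝ) T)} {C : ℝ}

lemma IsRegularPath.intervalIntegrable (hT : 0 ≤ T) (hm : IsRegularPath m C) {ψ : ℝ → ℝ}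
    (hψ : Continuous ψ) (a b : ℝ) :
    IntervalIntegrable (fun s => pairing ψ (m (projIcc 0 T hT s))) volume a b :=
  intervalIntegrable_pairing hT hm.1 hψ
    (measurable_of_rightContinuous hT fun t => (hm.2 ψ hψ t).1) a b

lemma IsRegularPath.rightContinuous (hT : 0 ≤ T) (hm : IsRegularPath m C) {ψ : ℝ → ℝ}
    (hψ : Continuous ψ) (u : ℝ) :
    ContinuousWithinAt (fun s => pairing ψ (m (projIcc 0 T hT s))) (Ici u) u :=
  ContinuousWithinAt.comp (t := Ici (projIcc 0 T hT u)) (hm.2 ψ hψ _).1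
    continuous_projIcc.continuousWithinAt fun _ hs => monotone_projIcc hT hs

lemma driftProcess_sub {ω : Ω} {C : ℝ} (hT : 0 ≤ T) (hω : IsRegularPath (fun t => μ t ω) C)
    {φ : ℝ → ℝ} (hφ : Continuous (deriv φ)) (r r' : Icc (0 : ℝ) T) :
    driftProcess μ φ r' ω - driftProcess μ φ r ω = pairing φ (μ r' ω) - pairing φ (μ r ω) +
      ∫ s in (r : ℝ)..r', pairing (deriv φ) (μ (projIcc 0 T hT s) ω) := by
  rw [← intervalIntegral.integral_interval_sub_left (a := 0) (hω.intervalIntegrable hT hφ _ _)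
    (hω.intervalIntegrable hT hφ _ _)]
  simp only [driftProcess]
  ring

end Path

/-- Bounds for `φ` and its derivative on `[0, T]` dominate the whole path by a multiple of `G`, so
the local martingale is a martingale. -/
lemma martingale_driftProcess [IsProbabilityMeasure Q] {hT : 0 ≤ T}
    (hdrift : ∀ φ ∈ testFunctions, IsLocalMartingale hT 𝓕 Q (driftProcess μ φ))
    (hG : Integrable G Q) (hreg : ∀ᵐ ω ∂Q, IsRegularPath (fun t => μ t ω) (G ω))
    {φ : ℝ → ℝ} (hφ : φ ∈ testFunctions) : Martingale (driftProcess μ φ) 𝓕 Q := by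
  have hφc : Continuous φ := hφ.1.continuous
  have hφ' : Continuous (deriv φ) := hφ.1.continuous_deriv (by norm_num)
  obtain ⟨B, hB⟩ := isCompact_Icc.exists_bound_of_continuousOn (hφc.continuousOn (s := Icc 0 T))
  obtain ⟨B', hB'⟩ := isCompact_Icc.exists_bound_of_continuousOn (hφ'.continuousOn (s := Icc 0 T))
  have hB0 : 0 ≤ B := (norm_nonneg _).trans (hB 0 ⟨le_rfl, hT⟩)
  have hB0' : 0 ≤ B' := (norm_nonneg _).trans (hB' 0 ⟨le_rfl, hT⟩)
  refine (hdrift φ hφ).martingale_of_dominated (hG.const_mul (B + B' * T)) ?_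
  filter_upwards [hreg] with ω hω t
  have h1 : |pairing φ (μ t ω)| ≤ B * G ω :=
    (abs_pairing_le hB _).trans (mul_le_mul_of_nonneg_left (hω.1 t) hB0)
  have h2 := intervalIntegral.norm_integral_le_of_norm_le_const (a := 0) (b := (t : ℝ))
    (C := B' * G ω)
    (f := fun s => pairing (deriv φ) (μ (projIcc 0 T (t.2.1.trans t.2.2) s) ω)) fun u _ =>
      (abs_pairing_le hB' _).trans (mul_le_mul_of_nonneg_left (hω.1 _) hB0')
  rw [sub_zero, abs_of_nonneg t.2.1] at h2
  have hG0 : 0 ≤ G ω := (totalMass_nonneg _).trans (hω.1 t)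
  calc _ ≤ _ := abs_add_le _ _
    _ ≤ B * G ω + B' * G ω * t := add_le_add h1 h2
    _ ≤ B * G ω + B' * G ω * T := by gcongr; exact t.2.2
    _ = _ := by ring

lemma translate_mem_testFunctions {g : ℝ → ℝ} (hg : ContDiff ℝ (⊤ : ℕ∞) g) {a : ℝ}
    (ha : deriv g a = 0) : (fun x => g (a + x)) ∈ testFunctions := by
  refine ⟨hg.comp (contDiff_const.add contDiff_id), ?_⟩
  rw [deriv_comp_const_add, add_zero, ha]

/-- The pairing of `g (r + ·)` with `μ_r`, for real times projected onto `[0, T]`. -/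
def translatedPairing (hT : 0 ≤ T) (μ : Icc (0 : ℝ) T → Ω → FiniteMeasure (Icc (0 : ℝ) T))
    (g : ℝ → ℝ) (r : ℝ) (ω : Ω) : ℝ :=
  pairing (fun x => g (r + x)) (μ (projIcc 0 T hT r) ω)

section Translate

variable {g : ℝ → ℝ}

lemma measurable_translatedPairing (hT : 0 ≤ T) (hμ : Adapted 𝓕 μ) (hg : Continuous g) (r : ℝ) :
    Measurable[𝓕 (projIcc 0 T hT r)] (translatedPairing hT μ g r) := by
  have hc : Continuous fun x => g (r + x) := by fun_prop
  obtain ⟨B, hB⟩ := isCompact_Icc.exists_bound_of_continuousOn (hc.continuousOn (s := Icc 0 T))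
  exact (measurable_pairing hc.measurable hB).comp (hμ _)

lemma integrable_translatedPairing (hT : 0 ≤ T) (hμ : Adapted 𝓕 μ) (hG : Integrable G Q)
    (hreg : ∀ᵐ ω ∂Q, IsRegularPath (fun t => μ t ω) (G ω)) (hg : Continuous g) (r : ℝ) :
    Integrable (translatedPairing hT μ g r) Q := by
  have hc : Continuous fun x => g (r + x) := by fun_prop
  obtain ⟨B, hB⟩ := isCompact_Icc.exists_bound_of_continuousOn (hc.continuousOn (s := Icc 0 T))
  have hB0 : 0 ≤ B := (norm_nonneg _).trans (hB 0 ⟨le_rfl, hT⟩)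
  refine (hG.const_mul B).mono'
    ((measurable_translatedPairing hT hμ hg r).mono (𝓕.le _) le_rfl).aestronglyMeasurable ?_
  filter_upwards [hreg] with ω hω
  exact (abs_pairing_le hB _).trans (mul_le_mul_of_nonneg_left (hω.1 _) hB0)

/-- The increment of `⟨g (r + ·), μ_r⟩` minus the martingale increment for `g (r' + ·)`. -/
def incrementDefect (hT : 0 ≤ T) (μ : Icc (0 : ℝ) T → Ω → FiniteMeasure (Icc (0 : ℝ) T))
    (g : ℝ → ℝ) (r r' : ℝ) (ω : Ω) : ℝ :=
  translatedPairing hT μ g r' ω - translatedPairing hT μ g r ω -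
    (driftProcess μ (fun x => g (r' + x)) (projIcc 0 T hT r') ω -
      driftProcess μ (fun x => g (r' + x)) (projIcc 0 T hT r) ω)

/-- The terms at `μ_{r'}` cancel because the test function is frozen at the later time `r'`. -/
lemma incrementDefect_eq (hT : 0 ≤ T) {ω : Ω} {C : ℝ} (hω : IsRegularPath (fun t => μ t ω) C)
    (hg : ContDiff ℝ 1 g) {r r' : ℝ} (hr : r ∈ Icc 0 T) (hr' : r' ∈ Icc 0 T) :
    incrementDefect hT μ g r r' ω =
      transportDefect (fun u => μ (projIcc 0 T hT u) ω) g r r' := by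
  have hg' : Continuous (deriv g) := hg.continuous_deriv le_rfl
  have hd : deriv (fun x => g (r' + x)) = fun x => deriv g (r' + x) := by
    funext x
    rw [deriv_comp_const_add]
  rw [incrementDefect, driftProcess_sub hT hω (by rw [hd]; fun_prop), hd, transportDefect,
    translatedPairing, translatedPairing, projIcc_of_mem hT hr, projIcc_of_mem hT hr']
  ring

/-- As a function of time in `[a, b]`, the integral over `A` is continuous with zero right
derivative, hence constant. The condition on `deriv g` makes every translate `g (r' + ·)` with `r' ≤
b` a test function. -/
lemma setIntegral_translatedPairing_eq [IsProbabilityMeasure Q] {hT : 0 ≤ T} (hμ : Adapted 𝓕 μ)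
    (hdrift : ∀ φ ∈ testFunctions, IsLocalMartingale hT 𝓕 Q (driftProcess μ φ))
    (hG : Integrable G Q) (hreg : ∀ᵐ ω ∂Q, IsRegularPath (fun t => μ t ω) (G ω))
    (hg : ContDiff ℝ (⊤ : ℕ∞) g) (hgs : HasCompactSupport g)
    {a b : ℝ} (ha : 0 ≤ a) (hab : a ≤ b) (hb : b ≤ T) (hg0 : ∀ u ≤ b, deriv g u = 0)
    {A : Set Ω} (hA : MeasurableSet[𝓕 (projIcc 0 T hT a)] A) :
    ∫ ω in A, translatedPairing hT μ g a ω ∂Q = ∫ ω in A, translatedPairing hT μ g b ω ∂Q := by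
  have hg1 : ContDiff ℝ 1 g := hg.of_le (by exact_mod_cast le_top)
  obtain ⟨L, hL⟩ := hgs.deriv.exists_bound_of_continuous (hg1.continuous_deriv le_rfl)
  have hL0 : 0 ≤ L := (norm_nonneg _).trans (hL 0)
  have hmem : ∀ r ∈ Icc a b, r ∈ Icc 0 T := fun r hr => ⟨ha.trans hr.1, hr.2.trans hb⟩
  have hD : ∀ r' ∈ Icc a b, Martingale (driftProcess μ fun x => g (r' + x)) 𝓕 Q := fun r' hr' =>
    martingale_driftProcess hdrift hG hreg (translate_mem_testFunctions hg (hg0 r' hr'.2))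
  have hFi := integrable_translatedPairing hT hμ hG hreg hg1.continuous
  have hVi : ∀ r r', r' ∈ Icc a b → Integrable (incrementDefect hT μ g r r') Q := fun r r' hr' =>
    ((hFi r').sub (hFi r)).sub (((hD r' hr').integrable _).sub ((hD r' hr').integrable _))
  have hVb : ∀ᵐ ω ∂Q, ∀ r ∈ Icc a b, ∀ r' ∈ Icc a b, r ≤ r' →
      |incrementDefect hT μ g r r' ω| ≤ 2 * L * G ω * (r' - r) := by
    filter_upwards [hreg] with ω hω r hr r' hr' hrr'
    rw [incrementDefect_eq hT hω hg1 (hmem r hr) (hmem r' hr')]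
    exact abs_transportDefect_le (fun u => hω.1 _) hg1 hL hrr'
  set h : ℝ → ℝ := fun r => ∫ ω in A, translatedPairing hT μ g r ω ∂Q with hh
  -- Since `A` belongs to the σ-algebra at time `a ≤ r`, the martingale increment integrates to zero
  -- over it and only the defect remains.
  have hsub : ∀ r ∈ Icc a b, ∀ r' ∈ Icc a b, r ≤ r' →
      h r' - h r = ∫ ω in A, incrementDefect hT μ g r r' ω ∂Q := by
    intro r hr r' hr' hrr'
    have h1 := (hD r' hr').setIntegral_eq (monotone_projIcc hT hrr')
      (𝓕.mono (monotone_projIcc hT hr.1) _ hA)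
    simp only [incrementDefect]
    rw [integral_sub, integral_sub, integral_sub, h1, sub_self, sub_zero]
    · exact ((hD r' hr').integrable _).integrableOn
    · exact ((hD r' hr').integrable _).integrableOn
    · exact (hFi _).integrableOn
    · exact (hFi _).integrableOn
    · exact ((hFi r').sub (hFi r)).integrableOn
    · exact (((hD r' hr').integrable _).sub ((hD r' hr').integrable _)).integrableOn
  have hGnn : 0 ≤ᵐ[Q] G := by
    filter_upwards [hreg] with ω hω
    exact (totalMass_nonneg _).trans (hω.1 ⟨0, le_rfl, hT⟩)
  have hbound : ∀ r ∈ Icc a b, ∀ r' ∈ Icc a b, r ≤ r' →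
      |h r' - h r| ≤ 2 * L * (∫ ω, G ω ∂Q) * (r' - r) := by
    intro r hr r' hr' hrr'
    rw [hsub r hr r' hr' hrr']
    have h2 : |∫ ω in A, incrementDefect hT μ g r r' ω ∂Q| ≤
        ∫ ω in A, 2 * L * G ω * (r' - r) ∂Q := by
      refine norm_integral_le_of_norm_le (f := incrementDefect hT μ g r r') (((hG.const_mul _).mul_const _).integrableOn) ?_
      exact ae_restrict_of_ae (hVb.mono fun ω hω => hω r hr r' hr' hrr')
    refine h2.trans ?_
    rw [integral_mul_const, integral_const_mul]
    have := setIntegral_le_integral (s := A) hG hGnn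
    have : 0 ≤ r' - r := sub_nonneg.2 hrr'
    gcongr
  have hcont : ContinuousOn h (Icc a b) := by
    refine (LipschitzOnWith.of_dist_le_mul (K := (2 * L * ∫ ω, G ω ∂Q).toNNReal)
      fun r hr r' hr' => ?_).continuousOn
    have hK : 0 ≤ 2 * L * ∫ ω, G ω ∂Q := mul_nonneg (by positivity) (integral_nonneg_of_ae hGnn)
    rw [Real.coe_toNNReal _ hK, Real.dist_eq, Real.dist_eq]
    rcases le_total r r' with hrr' | hrr'
    · rw [abs_sub_comm, abs_sub_comm r, abs_of_nonneg (sub_nonneg.2 hrr')]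
      exact hbound r hr r' hr' hrr'
    · rw [abs_of_nonneg (sub_nonneg.2 hrr')]
      exact hbound r' hr' r hr hrr'
  -- Paths may jump, so only the right derivative is accessible; with continuity of `h` this
  -- suffices. The Lipschitz bound on the defect dominates the difference quotients.
  have hderiv : ∀ r ∈ Ico a b, HasDerivWithinAt h 0 (Ici r) r := by
    intro r hr
    have hrI : r ∈ Icc a b := ⟨hr.1, hr.2.le⟩
    rw [← hasDerivWithinAt_Ioi_iff_Ici, hasDerivWithinAt_iff_tendsto_slope' self_notMem_Ioi]
    have hev : ∀ᶠ r' in 𝓝[>] r, r' ∈ Icc a b ∧ r < r' := by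
      filter_upwards [Ioo_mem_nhdsGT hr.2] with r' hr'
      exact ⟨⟨hr.1.trans hr'.1.le, hr'.2.le⟩, hr'.1⟩
    have hlim : Tendsto (fun r' => ∫ ω in A, (r' - r)⁻¹ * incrementDefect hT μ g r r' ω ∂Q)
        (𝓝[>] r) (𝓝 (∫ ω in A, (0 : ℝ) ∂Q)) := by
      refine tendsto_integral_filter_of_dominated_convergence (fun ω => 2 * L * G ω) ?_ ?_
        (hG.const_mul _).integrableOn ?_
      · filter_upwards [hev] with r' hr'
        exact ((hVi r r' hr'.1).const_mul _).aestronglyMeasurable.restrict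
      · filter_upwards [hev] with r' hr'
        refine ae_restrict_of_ae (hVb.mono fun ω hω => ?_)
        have hδ : 0 < r' - r := sub_pos.2 hr'.2
        rw [Real.norm_eq_abs, abs_mul, abs_inv, abs_of_pos hδ, inv_mul_le_iff₀ hδ, mul_comm]
        exact hω r hrI r' hr'.1 hr'.2.le
      · refine ae_restrict_of_ae (hreg.mono fun ω hω => ?_)
        refine (tendsto_transportDefect_div (fun u => hω.1 (projIcc 0 T hT u))
          (fun ψ hψ => hω.intervalIntegrable hT hψ) (fun ψ hψ => hω.rightContinuous hT hψ)
          hg1 hgs r).congr' ?_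
        filter_upwards [hev] with r' hr'
        rw [incrementDefect_eq hT hω hg1 (hmem r hrI) (hmem r' hr'.1)]
    rw [integral_zero] at hlim
    refine hlim.congr' ?_
    filter_upwards [hev] with r' hr'
    rw [integral_const_mul, ← hsub r hrI r' hr'.1 hr'.2.le, slope_def_module, smul_eq_mul]
  exact (constant_of_has_deriv_right_zero hcont hderiv b ⟨hab, le_rfl⟩).symm

end Translate

end Conservation

/-! ### Smooth approximation of the delivery-period indicator. -/

section Cutoff

/-- A smooth approximation of the indicator function of `(a, b]` that vanishes outside
`[a, b + 1]`. -/
def smoothCutoff (a b : ℝ) (n : ℕ) (u : ℝ) : ℝ :=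
  Real.smoothTransition ((n + 1) * (u - a)) * Real.smoothTransition (1 + (n + 1) * (b - u))

variable {a b : ℝ}

lemma contDiff_smoothCutoff (n : ℕ) : ContDiff ℝ (⊤ : ℕ∞) (smoothCutoff a b n) :=
  (Real.smoothTransition.contDiff.comp (by fun_prop)).mul
    (Real.smoothTransition.contDiff.comp (by fun_prop))

lemma smoothCutoff_nonneg (n : ℕ) (u : ℝ) : 0 ≤ smoothCutoff a b n u :=
  mul_nonneg (Real.smoothTransition.nonneg _) (Real.smoothTransition.nonneg _)

lemma smoothCutoff_le_one (n : ℕ) (u : ℝ) : smoothCutoff a b n u ≤ 1 :=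
  mul_le_one₀ (Real.smoothTransition.le_one _) (Real.smoothTransition.nonneg _)
    (Real.smoothTransition.le_one _)

lemma smoothCutoff_of_le (n : ℕ) {u : ℝ} (hu : u ≤ a) : smoothCutoff a b n u = 0 := by
  rw [smoothCutoff, Real.smoothTransition.zero_of_nonpos, zero_mul]
  exact mul_nonpos_of_nonneg_of_nonpos (by positivity) (by linarith)

lemma smoothCutoff_of_ge (n : ℕ) {u : ℝ} (hu : 1 ≤ (n + 1) * (u - b)) :
    smoothCutoff a b n u = 0 := by
  rw [smoothCutoff, Real.smoothTransition.zero_of_nonpos (x := 1 + _), mul_zero]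
  linarith

lemma smoothCutoff_of_notMem (n : ℕ) {u : ℝ} (hu : u ∉ Icc a (b + 1)) :
    smoothCutoff a b n u = 0 := by
  rcases le_or_gt u a with h | h
  · exact smoothCutoff_of_le n h
  · have h1 : b + 1 < u := by
      by_contra hne
      exact hu ⟨h.le, not_lt.1 hne⟩
    refine smoothCutoff_of_ge n ?_
    have : (0 : ℝ) ≤ n := Nat.cast_nonneg n
    nlinarith

/-- The half-open interval is hit exactly: the first factor is 0 at `a`, and the second is 1 at `b`,
for every `n`. -/
lemma tendsto_smoothCutoff (u : ℝ) :
    Tendsto (fun n => smoothCutoff a b n u) atTop (𝓝 ((Ioc a b).indicator 1 u)) := by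
  have hlarge : ∀ c > (0 : ℝ), ∀ᶠ n : ℕ in atTop, 1 ≤ ((n : ℝ) + 1) * c := fun c hc =>
    ((tendsto_natCast_atTop_atTop.atTop_add tendsto_const_nhds).atTop_mul_const hc).eventually_ge_atTop 1
  refine tendsto_const_nhds.congr' ?_
  rcases le_or_gt u a with h | h
  · refine Eventually.of_forall fun n => ?_
    simp [smoothCutoff_of_le n h, h.not_gt]
  rcases le_or_gt u b with h' | h'
  · filter_upwards [hlarge (u - a) (sub_pos.2 h)] with n hn
    rw [smoothCutoff, Real.smoothTransition.one_of_one_le hn, Real.smoothTransition.one_of_one_le]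
    · simp [h, h']
    · have : 0 ≤ ((n : ℝ) + 1) * (b - u) := mul_nonneg (by positivity) (by linarith)
      linarith
  · filter_upwards [hlarge (u - b) (sub_pos.2 h')] with n hn
    simp [smoothCutoff_of_ge n hn, h'.not_ge]

end Cutoff

/-! ### Càdlàg paths of a limit of martingales. -/

section RestrictedTime

variable {S T : ℝ}

lemma IsCadlag.comp_timeInclusion (h : S ≤ T) {f : Icc (0 : ℝ) T → ℝ} (hf : IsCadlag f) :
    IsCadlag fun t => f (timeInclusion h t) := fun t => by
  have hc : Continuous (timeInclusion h) := continuous_inclusion (Icc_subset_Icc_right h)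
  obtain ⟨l, hl⟩ := (hf (timeInclusion h t)).2
  refine ⟨ContinuousWithinAt.comp (t := Ici (timeInclusion h t)) (hf _).1 hc.continuousWithinAt
    fun _ hs => hs, l, hl.comp ?_⟩
  exact tendsto_nhdsWithin_iff.2 ⟨hc.continuousWithinAt, eventually_mem_nhdsWithin⟩

/-- A pointwise limit of càdlàg paths is càdlàg if it is approximated uniformly on the dyadic grid
by paths of arbitrarily large index. -/
lemma isCadlag_of_tendsto_of_gridPoint (hS : 0 ≤ S) {X : ℕ → Icc (0 : ℝ) S → ℝ}
    {F : Icc (0 : ℝ) S → ℝ} (hX : ∀ m, IsCadlag (X m))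
    (hlim : ∀ t, Tendsto (fun m => X m t) atTop (𝓝 (F t)))
    (h : ∀ j N : ℕ, ∃ m ≥ N, ∀ n k, |F (gridPoint hS n k) - X m (gridPoint hS n k)| <
      1 / ((j : ℝ) + 1)) : IsCadlag F := by
  refine IsCadlag.of_uniform_approx fun ε hε => ?_
  obtain ⟨j, hj⟩ := exists_nat_one_div_lt (half_pos hε)
  obtain ⟨m, -, hm⟩ := h j 0
  refine ⟨X m, hX m, fun t => ?_⟩
  -- Right-continuity of `F` is unknown, so the grid bound cannot be extended to `F` directly. It is
  -- extended for the càdlàg differences `X m' - X m`, each within `ε` on the grid, and then `m'`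
  -- runs through arbitrarily large indices.
  refine le_of_tendsto_of_frequently ((hlim t).sub_const (X m t)).abs
    (frequently_atTop.2 fun N => ?_)
  obtain ⟨m', hm', hm''⟩ := h j N
  refine ⟨m', hm', ?_⟩
  refine le_of_forall_gridPoint_le hS (f := fun t => |X m' t - X m t|)
    (fun t => ((hX m' t).1.sub (hX m t).1).abs) (fun n k => ?_) t
  have h1 := abs_lt.1 (hm n k)
  have h2 := abs_lt.1 (hm'' n k)
  exact abs_le.2 ⟨by linarith, by linarith⟩

variable {Ω : Type*} {mΩ : MeasurableSpace Ω} {Q : Measure Ω} [IsProbabilityMeasure Q]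

/-- A martingale that is the pointwise dominated limit of càdlàg martingales is càdlàg. -/
lemma ae_isCadlag_of_tendsto_of_dominated (hS : 0 ≤ S) {𝓕 : Filtration (Icc (0 : ℝ) S) mΩ}
    {X : ℕ → Icc (0 : ℝ) S → Ω → ℝ} {F : Icc (0 : ℝ) S → Ω → ℝ}
    (hX : ∀ m, Martingale (X m) 𝓕 Q) (hF : Martingale F 𝓕 Q)
    (hXc : ∀ m, ∀ᵐ ω ∂Q, IsCadlag fun t => X m t ω) {G : Ω → ℝ} (hG : Integrable G Q)
    (hXG : ∀ m t, ∀ᵐ ω ∂Q, |X m t ω| ≤ G ω)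
    (hlim : ∀ᵐ ω ∂Q, ∀ t, Tendsto (fun m => X m t ω) atTop (𝓝 (F t ω))) :
    ∀ᵐ ω ∂Q, IsCadlag fun t => F t ω := by
  set e : Icc (0 : ℝ) S := ⟨S, hS, le_rfl⟩ with he
  have hint : Tendsto (fun m => ENNReal.ofReal (∫ ω, |(F - X m) e ω| ∂Q)) atTop (𝓝 0) := by
    have h1 : Tendsto (fun m => ∫ ω, |(F - X m) e ω| ∂Q) atTop (𝓝 (∫ _, (0 : ℝ) ∂Q)) := by
      refine tendsto_integral_of_dominated_convergence (fun ω => |F e ω| + G ω) (fun m => ?_)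
        ((hF.integrable e).abs.add hG) (fun m => ?_) ?_
      · exact ((hF.integrable e).sub ((hX m).integrable e)).abs.aestronglyMeasurable
      · filter_upwards [hXG m e] with ω hω
        rw [Real.norm_eq_abs, abs_abs]
        exact (abs_sub _ _).trans (by gcongr)
      · filter_upwards [hlim] with ω hω
        simpa using ((hω e).const_sub (F e ω)).abs
    simpa using ENNReal.tendsto_ofReal h1
  -- The event that every `m ≥ N` fails lies in each single failure event, whose probability tends
  -- to 0 by Doob's inequality. Thus no almost surely convergent subsequence has to be selected.
  have hbad : ∀ j N : ℕ, ∀ᵐ ω ∂Q, ∃ m ≥ N, ∀ n k,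
      |F (gridPoint hS n k) ω - X m (gridPoint hS n k) ω| < 1 / ((j : ℝ) + 1) := by
    intro j N
    have hj : (0 : ℝ) < 1 / ((j : ℝ) + 1) := by positivity
    set B : ℕ → Set Ω := fun m =>
      {ω | ∃ n k, 1 / ((j : ℝ) + 1) ≤ |(F - X m) (gridPoint hS n k) ω|} with hB
    have hle : ∀ m ≥ N, ENNReal.ofReal (1 / ((j : ℝ) + 1)) * Q (⋂ m ≥ N, B m) ≤
        ENNReal.ofReal (∫ ω, |(F - X m) e ω| ∂Q) := fun m hm =>
      (mul_le_mul_right (measure_mono (biInter_subset_of_mem hm)) _).trans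
        (measure_exists_gridPoint_le hS (hF.sub (hX m)) hj)
    have hzero : ENNReal.ofReal (1 / ((j : ℝ) + 1)) * Q (⋂ m ≥ N, B m) = 0 :=
      le_antisymm (ge_of_tendsto hint ((eventually_ge_atTop N).mono hle)) zero_le
    have hQ : Q (⋂ m ≥ N, B m) = 0 :=
      (mul_eq_zero.1 hzero).resolve_left (ENNReal.ofReal_pos.2 hj).ne'
    filter_upwards [measure_eq_zero_iff_ae_notMem.1 hQ] with ω hω
    simpa [hB] using hω
  filter_upwards [ae_all_iff.2 hXc, hlim, ae_all_iff.2 fun j => ae_all_iff.2 (hbad j)] with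
    ω h1 h2 h3
  exact isCadlag_of_tendsto_of_gridPoint hS h1 h2 h3

end RestrictedTime

/-! ### The future price process. -/

section FuturePrice

variable {Ω : Type*} {mΩ : MeasurableSpace Ω} {Q : Measure Ω} [IsProbabilityMeasure Q]
  {T : ℝ} {𝓕 : Filtration (Icc (0 : ℝ) T) mΩ}
  {μ : Icc (0 : ℝ) T → Ω → FiniteMeasure (Icc (0 : ℝ) T)} {G : Ω → ℝ}

lemma martingale_pairing_translate {hT : 0 ≤ T} (hμ : Adapted 𝓕 μ)
    (hdrift : ∀ φ ∈ testFunctions, IsLocalMartingale hT 𝓕 Q (driftProcess μ φ))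
    (hG : Integrable G Q) (hreg : ∀ᵐ ω ∂Q, IsRegularPath (fun t => μ t ω) (G ω))
    {g : ℝ → ℝ} (hg : ContDiff ℝ (⊤ : ℕ∞) g) (hgs : HasCompactSupport g)
    {S : ℝ} (hST : S ≤ T) (hg0 : ∀ u ≤ S, deriv g u = 0) :
    Martingale (fun (t : Icc (0 : ℝ) S) ω => pairing (fun x => g (t + x)) (μ (timeInclusion hST t) ω))
      (restrictFiltration hST 𝓕) Q := by
  have hproj : ∀ t : Icc (0 : ℝ) S, projIcc 0 T hT t = timeInclusion hST t := fun t =>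
    projIcc_of_mem hT (timeInclusion hST t).2
  have heq : (fun (t : Icc (0 : ℝ) S) ω => pairing (fun x => g (t + x)) (μ (timeInclusion hST t) ω)) =
      fun t : Icc (0 : ℝ) S => translatedPairing hT μ g t := by
    funext t ω
    rw [translatedPairing, hproj]
  rw [heq]
  refine martingale_of_setIntegral_eq (fun t => ?_)
    (fun t => integrable_translatedPairing hT hμ hG hreg hg.continuous t) fun i j hij A hA => ?_
  · have := measurable_translatedPairing hT hμ hg.continuous t
    rw [hproj] at this
    exact this.stronglyMeasurable
  · refine setIntegral_translatedPairing_eq hμ hdrift hG hreg hg hgs i.2.1 hij (j.2.2.trans hST)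
      (fun u hu => hg0 u (hu.trans j.2.2)) ?_
    rw [hproj]
    exact hA

/-- The smooth payoffs `g n` are bounded uniformly in `n` and converge pointwise, so both assertions
pass to the limit, dominated by `|B| * G`. -/
lemma martingale_and_isCadlag_futurePrice {hT : 0 ≤ T} (hμ : Adapted 𝓕 μ)
    (hdrift : ∀ φ ∈ testFunctions, IsLocalMartingale hT 𝓕 Q (driftProcess μ φ))
    (hG : Integrable G Q) (hreg : ∀ᵐ ω ∂Q, IsRegularPath (fun t => μ t ω) (G ω))
    {w : ℝ → ℝ → ℝ → ℝ} {τ₁ τ₂ : ℝ} (hw : ContDiff ℝ (⊤ : ℕ∞) fun u => w u τ₁ τ₂)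
    (h₀ : 0 ≤ τ₁) (h₁ : τ₁ ≤ T) :
    Martingale (fun t => futurePrice w μ τ₁ τ₂ (timeInclusion h₁ t)) (restrictFiltration h₁ 𝓕) Q ∧
      ∀ᵐ ω ∂Q, IsCadlag fun t => futurePrice w μ τ₁ τ₂ (timeInclusion h₁ t) ω := by
  set g : ℕ → ℝ → ℝ := fun n u => smoothCutoff τ₁ τ₂ n u * w u τ₁ τ₂ with hgdef
  set f : ℝ → ℝ := (Ioc τ₁ τ₂).indicator fun u => w u τ₁ τ₂ with hfdef
  obtain ⟨B, hB⟩ := (isCompact_Icc (a := τ₁) (b := τ₂ + 1)).exists_bound_of_continuousOn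
    hw.continuous.continuousOn
  have hgB : ∀ n u, |g n u| ≤ |B| := fun n u => by
    by_cases hu : u ∈ Icc τ₁ (τ₂ + 1)
    · rw [hgdef, abs_mul, abs_of_nonneg (smoothCutoff_nonneg n u)]
      calc _ ≤ 1 * |w u τ₁ τ₂| := by gcongr; exact smoothCutoff_le_one n u
        _ ≤ |B| := by rw [one_mul]; exact (hB u hu).trans (le_abs_self B)
    · simp [hgdef, smoothCutoff_of_notMem n hu]
  have hgf : ∀ u, Tendsto (fun n => g n u) atTop (𝓝 (f u)) := fun u => by
    have := (tendsto_smoothCutoff (a := τ₁) (b := τ₂) u).mul_const (w u τ₁ τ₂)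
    convert! this using 2
    by_cases hu : u ∈ Ioc τ₁ τ₂ <;> simp [hfdef, hu]
  have hfB : ∀ u, |f u| ≤ |B| := fun u => le_of_tendsto' (hgf u).abs fun n => hgB n u
  have hg : ∀ n, ContDiff ℝ (⊤ : ℕ∞) (g n) := fun n => (contDiff_smoothCutoff n).mul hw
  have hgs : ∀ n, HasCompactSupport (g n) := fun n =>
    HasCompactSupport.intro (isCompact_Icc (a := τ₁) (b := τ₂ + 1)) fun u hu => by
      simp [hgdef, smoothCutoff_of_notMem n hu]
  -- At `u = τ₁` the function vanishes only on the left, and the left derivative determines the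
  -- derivative.
  have hg0 : ∀ n, ∀ u ≤ τ₁, deriv (g n) u = 0 := fun n u hu => by
    have h1 : HasDerivWithinAt (g n) (deriv (g n) u) (Iic u) u :=
      ((hg n).differentiable (by norm_num) u).hasDerivAt.hasDerivWithinAt
    have h2 : HasDerivWithinAt (g n) 0 (Iic u) u :=
      (hasDerivWithinAt_const u (Iic u) (0 : ℝ)).congr
        (fun v hv => by simp [hgdef, smoothCutoff_of_le n ((mem_Iic.1 hv).trans hu)])
        (by simp [hgdef, smoothCutoff_of_le n hu])
    exact (uniqueDiffOn_Iic u u self_mem_Iic).eq_deriv _ h1 h2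
  set X : ℕ → Icc (0 : ℝ) τ₁ → Ω → ℝ := fun n t ω =>
    pairing (fun x => g n (t + x)) (μ (timeInclusion h₁ t) ω) with hX
  have hXm : ∀ n, Martingale (X n) (restrictFiltration h₁ 𝓕) Q := fun n =>
    martingale_pairing_translate hμ hdrift hG hreg (hg n) (hgs n) h₁ (hg0 n)
  have hXc : ∀ n, ∀ᵐ ω ∂Q, IsCadlag fun t => X n t ω := fun n => by
    filter_upwards [hreg] with ω hω
    exact (isCadlag_pairing_translate hω.1 hω.2 (hg n).continuous (hgs n)).comp_timeInclusion h₁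
  have hXG : ∀ n t, ∀ᵐ ω ∂Q, |X n t ω| ≤ |B| * G ω := fun n t => by
    filter_upwards [hreg] with ω hω
    exact (abs_pairing_le (fun x _ => hgB n _) _).trans
      (mul_le_mul_of_nonneg_left (hω.1 _) (abs_nonneg B))
  have hlim : ∀ t ω, Tendsto (fun n => X n t ω) atTop
      (𝓝 (futurePrice w μ τ₁ τ₂ (timeInclusion h₁ t) ω)) := fun t ω =>
    tendsto_integral_of_dominated_convergence (fun _ => |B|)
      (fun n => ((hg n).continuous.comp
        (continuous_const.add continuous_subtype_val)).aestronglyMeasurable)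
      (integrable_const _) (fun n => ae_of_all _ fun x => hgB n _) (ae_of_all _ fun x => hgf _)
  have hfm : Measurable f := hw.continuous.measurable.indicator measurableSet_Ioc
  have hadp : StronglyAdapted (restrictFiltration h₁ 𝓕)
      fun t => futurePrice w μ τ₁ τ₂ (timeInclusion h₁ t) := fun t => by
    have h2 : Measurable fun x => f (t + x) := hfm.comp (measurable_const.add measurable_id)
    exact ((measurable_pairing h2 fun x _ => hfB _).comp (hμ (timeInclusion h₁ t))).stronglyMeasurable
  have hF := Martingale.of_tendsto_of_dominated hXm hadp (hG.const_mul |B|) hXG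
    fun t => ae_of_all _ (hlim t)
  exact ⟨hF, ae_isCadlag_of_tendsto_of_dominated h₀ hXm hF hXc (hG.const_mul |B|) hXG
    (ae_of_all _ fun ω t => hlim t ω)⟩

end FuturePrice

end MeasureHJM

end

theorem theorem3p1 {Ω : Type*} {mΩ : MeasurableSpace Ω} (P : Measure Ω) [IsProbabilityMeasure P]
    (T : ℝ) (hT : 0 < T) (𝓕 : Filtration (Icc (0 : ℝ) T) mΩ) [𝓕.IsRightContinuous]
    (w : ℝ → ℝ → ℝ → ℝ)
    (hw : ∀ τ₁ τ₂ : ℝ, 0 ≤ τ₁ → τ₁ < τ₂ → τ₂ ≤ T → ContDiff ℝ (⊤ : ℕ∞) (fun u => w u τ₁ τ₂))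
    (Q : Measure Ω) [IsProbabilityMeasure Q] (hQP : Q ≪ P) (hPQ : P ≪ Q)
    (μ : Icc (0 : ℝ) T → Ω → FiniteMeasure (Icc (0 : ℝ) T)) (hμ : Adapted 𝓕 μ)
    (hsup : ∫⁻ ω, ⨆ t, (μ t ω : Measure (Icc (0 : ℝ) T)) univ ∂Q < ∞)
    (hdrift : ∀ φ ∈ MeasureHJM.testFunctions,
      MeasureHJM.IsLocalMartingale hT.le 𝓕 Q (MeasureHJM.driftProcess μ φ)) :
    (∀ (τ₁ τ₂ : ℝ) (_ : 0 ≤ τ₁) (h₁ : τ₁ < τ₂) (h₂ : τ₂ ≤ T),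
      Martingale
        (fun t => MeasureHJM.futurePrice w μ τ₁ τ₂
          (MeasureHJM.timeInclusion (h₁.le.trans h₂) t))
        (MeasureHJM.restrictFiltration (h₁.le.trans h₂) 𝓕) Q ∧
      ∀ᵐ ω ∂Q, MeasureHJM.IsCadlag fun t => MeasureHJM.futurePrice w μ τ₁ τ₂
          (MeasureHJM.timeInclusion (h₁.le.trans h₂) t) ω) ∧
    MeasureHJM.NAFLVR P 𝓕 (MeasureHJM.futurePrice w μ) := by
  obtain ⟨G, hG, hreg⟩ := MeasureHJM.exists_integrable_ae_isRegularPath hT.le hμ hsup hdrift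
  have key := fun (τ₁ τ₂ : ℝ) (h₀ : 0 ≤ τ₁) (h₁ : τ₁ < τ₂) (h₂ : τ₂ ≤ T) =>
    MeasureHJM.martingale_and_isCadlag_futurePrice hμ hdrift hG hreg (hw τ₁ τ₂ h₀ h₁ h₂) h₀
      (h₁.le.trans h₂)
  exact ⟨key, Q, inferInstance, hQP, hPQ, fun τ₁ τ₂ h₀ h₁ h₂ =>
    MeasureHJM.isLocalMartingale_of_martingale h₀ (key τ₁ τ₂ h₀ h₁ h₂).1 (key τ₁ τ₂ h₀ h₁ h₂).2⟩
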